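/- Let $\mathbf X$ be a Banach space over $\mathbb R$ or $\mathbb C$, and let $\mathcal L(\mathbf X)$ be the space of bounded linear operators on $\mathbf X$. For a function $S:[0,\infty)\to\mathcal L(\mathbf X)$, its strong derivative at $0$ is the linear operator $$S'(0)\psi=\lim_{h\to 0+}h^{-1}\bigl(S(h)\psi-S(0)\psi\bigr),$$ with domain $D(S'(0))$ consisting of all $\psi\in\mathbf X$ for which this limit exists in norm. Let $\mathcal F_{\mathbf X}$ be the set of all functions $F:[0,\infty)\to\mathcal L(\mathbf X)$ such that $F(0)=I$, the domain $D(F'(0))$ is dense in $\mathbf X$, and there exist $M\ge 1$ and $a\in\mathbb R$ with $$\bigl\|F(s/n)^m\bigr\|\le M\exp\Bigl(\frac{am}{n}s\Bigr)\qquad\text{for all integers } n,m\ge 1 \text{ and all } s\ge 0.$$ A $C_0$-semigroup is a strongly continuous function $T:[0,\infty)\to\mathcal L(\mathbf X)$ with $T(0)=I$, $T(l+m)=T(l)T(m)$ for all $l,m\ge 0$, and $\|T(s)\|\le Me^{as}$ for all $s\ge0$, for some constants $M>1$, $a\in\mathbb R$; its generator is $T'(0)$. Theorem. Let $Z$ be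 a densely defined linear operator in $\mathbf X$ and let $t>0$. Let $F\in\mathcal F_{\mathbf X}$ be such that $D(Z)\subseteq D(F'(0))$ and $F'(0)f=Zf$ for all $f\in D(Z)$. Then $Z$ is closable and its closure is the generator of a $C_0$-semigroup if and only if there exists a linear subspace $\mathbf A\subseteq D(Z)$, dense in $\mathbf X$, such that for all $f\in\mathbf A$ and all $s\ge 0$ there exists a sequence $(f_n)_{n\ge1}$ in $D(Z)$ (depending on $f$ and $s$) with the following properties: (a) $\displaystyle\lim_{n\to\infty}\bigl\|F(t/n)^{[ns]}f-f_n\bigr\|=0$, where $[\,\cdot\,]$ denotes the integer part; (b) the sets $\{Zf_n: n\ge 1\}$ and $\{f_n:n\ge1\}$ are precompact (i.e. have compact closure) in the norm topology of $\mathbf X$. -/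

import Mathlib

open Filter Topology Set
open scoped NNReal

noncomputable section

/-- `y` is the strong derivative at `0` of `S : [0, ∞) → L(E)` applied to `ψ`:
`y = lim_{h → 0, h > 0} h⁻¹ (S h ψ - S 0 ψ)` in norm. -/
def HasStrongDerivZero {𝕜 E : Type*} [RCLike 𝕜] [NormedAddCommGroup E] [NormedSpace 𝕜 E]
    (S : ℝ≥0 → E →L[𝕜] E) (ψ y : E) : Prop :=
  Tendsto (fun h : ℝ≥0 => (((h : ℝ) : 𝕜))⁻¹ • (S h ψ - S 0 ψ)) (𝓝[≠] 0) (𝓝 y)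

theorem HasStrongDerivZero.unique {𝕜 E : Type*} [RCLike 𝕜] [NormedAddCommGroup E]
    [NormedSpace 𝕜 E] {S : ℝ≥0 → E →L[𝕜] E} {ψ y z : E}
    (hy : HasStrongDerivZero S ψ y) (hz : HasStrongDerivZero S ψ z) : y = z :=
  tendsto_nhds_unique hy hz

theorem HasStrongDerivZero.add {𝕜 E : Type*} [RCLike 𝕜] [NormedAddCommGroup E]
    [NormedSpace 𝕜 E] {S : ℝ≥0 → E →L[𝕜] E} {ψ φ y z : E}
    (hy : HasStrongDerivZero S ψ y) (hz : HasStrongDerivZero S φ z) :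
    HasStrongDerivZero S (ψ + φ) (y + z) := by
  refine (Tendsto.add hy hz).congr fun h => ?_
  rw [← smul_add, map_add, map_add]
  congr 1
  abel

theorem HasStrongDerivZero.smul {𝕜 E : Type*} [RCLike 𝕜] [NormedAddCommGroup E]
    [NormedSpace 𝕜 E] {S : ℝ≥0 → E →L[𝕜] E} {ψ y : E} (c : 𝕜)
    (hy : HasStrongDerivZero S ψ y) : HasStrongDerivZero S (c • ψ) (c • y) := by
  refine (Tendsto.const_smul hy c).congr fun h => ?_
  rw [map_smul, map_smul, ← smul_sub, smul_comm]

theorem HasStrongDerivZero.zero {𝕜 E : Type*} [RCLike 𝕜] [NormedAddCommGroup E]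
    [NormedSpace 𝕜 E] (S : ℝ≥0 → E →L[𝕜] E) : HasStrongDerivZero S 0 0 := by
  simp [HasStrongDerivZero]

/-- The strong derivative `S'(0)` of `S : [0, ∞) → L(E)` at `0`, as an unbounded linear operator
whose domain is the space of all vectors at which the limit exists. -/
def strongDerivZero {𝕜 E : Type*} [RCLike 𝕜] [NormedAddCommGroup E] [NormedSpace 𝕜 E]
    (S : ℝ≥0 → E →L[𝕜] E) : E →ₗ.[𝕜] E where
  domain :=
    { carrier := {ψ | ∃ y, HasStrongDerivZero S ψ y}
      add_mem' := fun ⟨y, hy⟩ ⟨z, hz⟩ => ⟨y + z, hy.add hz⟩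
      zero_mem' := ⟨0, HasStrongDerivZero.zero S⟩
      smul_mem' := fun c _ ⟨y, hy⟩ => ⟨c • y, hy.smul c⟩ }
  toFun :=
    { toFun := fun ψ => Classical.choose ψ.2
      map_add' := fun ψ φ => (Classical.choose_spec (ψ + φ).2).unique
        ((Classical.choose_spec ψ.2).add (Classical.choose_spec φ.2))
      map_smul' := fun c ψ => (Classical.choose_spec (c • ψ).2).unique
        ((Classical.choose_spec ψ.2).smul c) }

theorem mem_strongDerivZero_domain {𝕜 E : Type*} [RCLike 𝕜] [NormedAddCommGroup E]
    [NormedSpace 𝕜 E] {S : ℝ≥0 → E →L[𝕜] E} {ψ : E} :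
    ψ ∈ (strongDerivZero S).domain ↔ ∃ y, HasStrongDerivZero S ψ y :=
  Iff.rfl

theorem strongDerivZero_spec {𝕜 E : Type*} [RCLike 𝕜] [NormedAddCommGroup E]
    [NormedSpace 𝕜 E] (S : ℝ≥0 → E →L[𝕜] E) (ψ : (strongDerivZero S).domain) :
    HasStrongDerivZero S ψ (strongDerivZero S ψ) :=
  Classical.choose_spec ψ.2

/-- The class `𝓕^E_{M,a}`. -/
structure IsChernoffFunctionWith {𝕜 E : Type*} [RCLike 𝕜] [NormedAddCommGroup E]
    [NormedSpace 𝕜 E] (M a : ℝ) (F : ℝ≥0 → E →L[𝕜] E) : Prop where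
  map_zero : F 0 = ContinuousLinearMap.id 𝕜 E
  norm_pow_le : ∀ n m : ℕ, 0 < n → 0 < m → ∀ s : ℝ≥0,
    ‖F (s / n) ^ m‖ ≤ M * Real.exp (a * m / n * s)
  dense_domain : Dense ((strongDerivZero F).domain : Set E)

/-- The class `𝓕_E`, the union of `𝓕^E_{M,a}` over `M ≥ 1` and real `a`. -/
def IsChernoffFunction {𝕜 E : Type*} [RCLike 𝕜] [NormedAddCommGroup E] [NormedSpace 𝕜 E]
    (F : ℝ≥0 → E →L[𝕜] E) : Prop :=
  ∃ M a : ℝ, 1 ≤ M ∧ IsChernoffFunctionWith M a F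

/-- `C₀`-semigroups of bounded operators; `L(E)` carries the strong operator topology. -/
structure IsC0Semigroup {𝕜 E : Type*} [RCLike 𝕜] [NormedAddCommGroup E] [NormedSpace 𝕜 E]
    (T : ℝ≥0 → E →L[𝕜] E) : Prop where
  map_zero : T 0 = ContinuousLinearMap.id 𝕜 E
  map_add : ∀ l m : ℝ≥0, T (l + m) = (T l).comp (T m)
  strongly_continuous : ∀ x : E, Continuous fun s => T s x
  exp_bounded : ∃ M a : ℝ, 1 < M ∧ ∀ s : ℝ≥0, ‖T s‖ ≤ M * Real.exp (a * s)

/-- `G` is the generator of some `C₀`-semigroup (equality includes equality of domains). -/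
def IsC0Generator {𝕜 E : Type*} [RCLike 𝕜] [NormedAddCommGroup E] [NormedSpace 𝕜 E]
    (G : E →ₗ.[𝕜] E) : Prop :=
  ∃ T : ℝ≥0 → E →L[𝕜] E, IsC0Semigroup T ∧ G = strongDerivZero T

/-- Precompact (relatively compact) subsets. -/
def IsPrecompactSet {E : Type*} [TopologicalSpace E] (K : Set E) : Prop :=
  IsCompact (closure K)

end

/-! ### Telescoping estimates for powers of one operator. -/

section DiscreteEvolution

variable {𝕜 E : Type*} [RCLike 𝕜] [NormedAddCommGroup E] [NormedSpace 𝕜 E]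

/-! The argument is "stability plus consistency". The bound on powers in the class of `F` gives
stability: `‖F(h)^m‖` is bounded as long as `mh` is. Consistency is `F(h)f = f + hF'(0)f + o(h)` on
the domain of `F'(0)`.

If the closure of `Z` generates `T`, consistency along the orbit `T(iδ)f` and stability yield
Chernoff's formula `F(t/n)^[ns] f → T(ts)f` for `f ∈ D(Z)` (`IsChernoffFunction.tendsto_pow_apply`),
with no resolvents. The pair `(T(ts)f, T(ts)Zf)` lies in the closure of the graph of `Z`; a sequence
in the graph converging to it supplies `f_n`.

Conversely, fix a nonprincipal ultrafilter on `ℕ`. Precompactness makes `f_n` and `Zf_n` converge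
along it, to a pair in the closure of the graph of `Z`, and by (a) the iterates have the same limit
as `f_n`. By stability the iterates then converge on all of `X`, to a semigroup `T` whose generator
extends `F'(0)`, hence `Z` (`IsChernoffFunction.exists_isC0Semigroup`). Generators are closed, so
`Z` is closable. Orbits of the dense space `A` stay in the domain of the closure, so it is the full
generator, by the core criterion `IsC0Semigroup.graph_strongDerivZero_le`. -/

theorem pow_apply_sub_eq_sum (L : E →L[𝕜] E) (k : ℕ) (f : E) :
    (L ^ k) f - f = ∑ j ∈ Finset.range k, (L ^ j) (L f - f) := by
  have h := Finset.sum_range_sub (fun j => (L ^ j) f) k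
  simp only [pow_zero, one_apply_eq_self] at h
  rw [← h]
  refine Finset.sum_congr rfl fun j _ => ?_
  rw [map_sub, pow_succ, mul_apply_eq_comp]

/-- In the telescoping sum the true increment `L f - f` is traded for a model increment `g`, later
`h` times a derivative; each power amplifies the defect by at most `C`. -/
theorem norm_pow_sub_sub_sum_le (L : E →L[𝕜] E) {C : ℝ} {k : ℕ} (hC : ∀ j < k, ‖L ^ j‖ ≤ C)
    (f g : E) :
    ‖(L ^ k) f - f - ∑ j ∈ Finset.range k, (L ^ j) g‖ ≤ k * (C * ‖L f - f - g‖) := by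
  rw [pow_apply_sub_eq_sum, ← Finset.sum_sub_distrib]
  calc _ ≤ ∑ j ∈ Finset.range k, C * ‖L f - f - g‖ := by
        refine norm_sum_le_of_le _ fun j hj => ?_
        rw [← map_sub]
        exact (L ^ j).le_of_opNorm_le (hC j (Finset.mem_range.1 hj)) _
    _ = _ := by simp

theorem norm_pow_sub_sub_smul_le (L : E →L[𝕜] E) {C ε : ℝ} {k : ℕ} (hC : ∀ j < k, ‖L ^ j‖ ≤ C)
    (f g : E) (hε : ∀ j < k, ‖(L ^ j) g - g‖ ≤ ε) :
    ‖(L ^ k) f - f - (k : 𝕜) • g‖ ≤ k * (C * ‖L f - f - g‖ + ε) := by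
  have h1 := norm_pow_sub_sub_sum_le L hC f g
  have h2 : ‖∑ j ∈ Finset.range k, (L ^ j) g - (k : 𝕜) • g‖ ≤ k * ε := by
    have : (k : 𝕜) • g = ∑ j ∈ Finset.range k, g := by simp [Nat.cast_smul_eq_nsmul]
    rw [this, ← Finset.sum_sub_distrib]
    calc _ ≤ ∑ j ∈ Finset.range k, ε :=
          norm_sum_le_of_le _ fun j hj => hε j (Finset.mem_range.1 hj)
      _ = _ := by simp
  calc _ ≤ _ := norm_sub_le_norm_sub_add_norm_sub _ (∑ j ∈ Finset.range k, (L ^ j) g) _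
    _ ≤ k * (C * ‖L f - f - g‖) + k * ε := by
      refine add_le_add h1 h2
    _ = _ := by ring

theorem norm_pow_sub_le (L : E →L[𝕜] E) {C : ℝ} {k : ℕ} (hC : ∀ j < k, ‖L ^ j‖ ≤ C) (f : E) :
    ‖(L ^ k) f - f‖ ≤ k * (C * ‖L f - f‖) := by
  simpa using norm_pow_sub_sub_smul_le L hC f 0 (ε := 0) (by simp)

end DiscreteEvolution

/-! ### The strong derivative as a first-order expansion. -/

section StrongDeriv

variable {𝕜 E : Type*} [RCLike 𝕜] [NormedAddCommGroup E] [NormedSpace 𝕜 E]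

theorem mem_graph_strongDerivZero {S : ℝ≥0 → E →L[𝕜] E} {x y : E} :
    (x, y) ∈ (strongDerivZero S).graph ↔ HasStrongDerivZero S x y := by
  rw [LinearPMap.mem_graph_iff]
  constructor
  · rintro ⟨z, rfl, rfl⟩
    exact strongDerivZero_spec S z
  · intro h
    exact ⟨⟨x, y, h⟩, rfl, (strongDerivZero_spec S ⟨x, y, h⟩).unique h⟩

theorem norm_ofReal_coe_smul (h : ℝ≥0) (y : E) : ‖((h : ℝ) : 𝕜) • y‖ = h * ‖y‖ := by
  rw [norm_smul, RCLike.norm_ofReal, NNReal.abs_eq]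

/-- Clearing `h⁻¹` makes the estimate hold trivially at `h = 0`, so the punctured neighbourhood
becomes a full one and any family `h → 0` may be substituted. -/
theorem hasStrongDerivZero_iff_eventually {S : ℝ≥0 → E →L[𝕜] E}
    (hS : S 0 = ContinuousLinearMap.id 𝕜 E) {f y : E} :
    HasStrongDerivZero S f y ↔
      ∀ ε > 0, ∀ᶠ h in 𝓝 (0 : ℝ≥0), ‖S h f - f - ((h : ℝ) : 𝕜) • y‖ ≤ ε * h := by
  have key : ∀ (ε : ℝ) (h : ℝ≥0), h ≠ 0 →
      (dist ((((h : ℝ) : 𝕜))⁻¹ • (S h f - S 0 f)) y ≤ ε ↔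
        ‖S h f - f - ((h : ℝ) : 𝕜) • y‖ ≤ ε * h) := by
    intro ε h h0
    have h0' : ((h : ℝ) : 𝕜) ≠ 0 := by simpa using h0
    have hpos : (0 : ℝ) < h := by positivity
    have : S h f - f - ((h : ℝ) : 𝕜) • y =
        ((h : ℝ) : 𝕜) • ((((h : ℝ) : 𝕜))⁻¹ • (S h f - S 0 f) - y) := by
      rw [smul_sub, smul_inv_smul₀ h0', hS]; rfl
    rw [this, norm_ofReal_coe_smul, dist_eq_norm, mul_comm, mul_le_mul_iff_left₀ hpos]
  unfold HasStrongDerivZero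
  constructor
  · intro H ε hε
    have := (Metric.tendsto_nhds.1 H) ε hε
    rw [eventually_nhdsWithin_iff] at this
    filter_upwards [this] with h hh
    by_cases h0 : h = 0
    · subst h0; simp [hS]
    · exact (key ε h h0).1 (hh h0).le
  · intro H
    refine Metric.tendsto_nhds.2 fun ε hε => ?_
    rw [eventually_nhdsWithin_iff]
    filter_upwards [H (ε / 2) (by positivity)] with h hh h0
    exact ((key _ h h0).2 hh).trans_lt (by linarith)

theorem HasStrongDerivZero.eventually_norm_le {S : ℝ≥0 → E →L[𝕜] E}
    (hS : S 0 = ContinuousLinearMap.id 𝕜 E) {f y : E} (hf : HasStrongDerivZero S f y)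
    {ε : ℝ} (hε : 0 < ε) : ∀ᶠ h in 𝓝 (0 : ℝ≥0), ‖S h f - f‖ ≤ (‖y‖ + ε) * h := by
  filter_upwards [(hasStrongDerivZero_iff_eventually hS).1 hf ε hε] with h hh
  have := norm_le_norm_add_norm_sub' (S h f - f) (((h : ℝ) : 𝕜) • y)
  rw [norm_ofReal_coe_smul] at this
  linarith

end StrongDeriv

/-! ### Stability and consistency of Chernoff functions. -/

section Chernoff

variable {𝕜 E : Type*} [RCLike 𝕜] [NormedAddCommGroup E] [NormedSpace 𝕜 E]

/-- The case `n = 1` of the defining bound already covers every step `h`. Replacing `a` by `|a|`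
makes the bound increasing in the total time `mh`. -/
theorem IsChernoffFunction.exists_norm_pow_le {F : ℝ≥0 → E →L[𝕜] E} (hF : IsChernoffFunction F) :
    ∃ M ω : ℝ, 1 ≤ M ∧ 0 ≤ ω ∧
      ∀ (h : ℝ≥0) (m : ℕ), ‖F h ^ m‖ ≤ M * Real.exp (ω * (m * h)) := by
  obtain ⟨M, a, hM, hF⟩ := hF
  refine ⟨M, |a|, hM, abs_nonneg a, fun h m => ?_⟩
  rcases Nat.eq_zero_or_pos m with rfl | hm
  · have h1 : ‖(1 : E →L[𝕜] E)‖ ≤ 1 := ContinuousLinearMap.norm_id_le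
    simpa using h1.trans hM
  · have := hF.norm_pow_le 1 m one_pos hm h
    simp only [Nat.cast_one, div_one] at this
    refine this.trans ?_
    rw [mul_assoc]
    gcongr
    exact le_abs_self a

theorem IsChernoffFunction.map_zero {F : ℝ≥0 → E →L[𝕜] E} (hF : IsChernoffFunction F) :
    F 0 = ContinuousLinearMap.id 𝕜 E :=
  let ⟨_, _, _, h⟩ := hF; h.map_zero

theorem IsChernoffFunction.dense_domain {F : ℝ≥0 → E →L[𝕜] E} (hF : IsChernoffFunction F) :
    Dense ((strongDerivZero F).domain : Set E) :=
  let ⟨_, _, _, h⟩ := hF; h.dense_domain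

theorem IsChernoffFunction.exists_norm_pow_le_of_le {F : ℝ≥0 → E →L[𝕜] E}
    (hF : IsChernoffFunction F) (τ : ℝ) :
    ∃ C : ℝ, 1 ≤ C ∧ ∀ (h : ℝ≥0) (m : ℕ), (m * h : ℝ) ≤ τ → ‖F h ^ m‖ ≤ C := by
  obtain ⟨M, ω, hM, hω, h⟩ := hF.exists_norm_pow_le
  refine ⟨M * Real.exp (ω * |τ|), ?_, fun r m hm => (h r m).trans ?_⟩
  · exact one_le_mul_of_one_le_of_one_le hM (Real.one_le_exp (by positivity))
  · gcongr
    exact hm.trans (le_abs_self τ)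

/-- Powers `F(h)^j` are close to the identity at a given vector as long as `jh` is small. -/
theorem IsChernoffFunction.exists_forall_norm_pow_sub_le {F : ℝ≥0 → E →L[𝕜] E}
    (hF : IsChernoffFunction F) (g : E) {ε : ℝ} (hε : 0 < ε) :
    ∃ δ > 0, ∀ᶠ h : ℝ≥0 in 𝓝 0, ∀ j : ℕ, (j * h : ℝ) ≤ δ → ‖(F h ^ j) g - g‖ ≤ ε := by
  obtain ⟨C, hC1, hC⟩ := hF.exists_norm_pow_le_of_le 1
  obtain ⟨ψ, hψ, hgψ⟩ := Metric.mem_closure_iff.1 (hF.dense_domain g) (ε / (2 * (C + 1)))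
    (by positivity)
  obtain ⟨y, hy⟩ := mem_strongDerivZero_domain.1 hψ
  -- Up to total time `1`, the powers move `ψ` by at most `jh · C(‖y‖ + 1)`; the second entry makes
  -- this at most `ε / 2`.
  refine ⟨min 1 (ε / (2 * (C * (‖y‖ + 1)))), by positivity, ?_⟩
  filter_upwards [hy.eventually_norm_le hF.map_zero one_pos] with h hh j hj
  have hj1 : (j * h : ℝ) ≤ 1 := hj.trans (min_le_left _ _)
  have hj2 := hj.trans (min_le_right _ _)
  have hCi : ∀ i ≤ j, ‖F h ^ i‖ ≤ C := fun i hi => hC h i (le_trans (by gcongr) hj1)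
  have h1 := norm_pow_sub_le (F h) (fun i hi => hCi i (le_of_lt hi)) ψ
  have h2 : (j : ℝ) * (C * ‖F h ψ - ψ‖) ≤ ε / 2 := by
    calc (j : ℝ) * (C * ‖F h ψ - ψ‖) ≤ j * (C * ((‖y‖ + 1) * h)) := by gcongr
      _ = (j * h) * (C * (‖y‖ + 1)) := by ring
      _ ≤ ε / (2 * (C * (‖y‖ + 1))) * (C * (‖y‖ + 1)) := by gcongr
      _ = ε / 2 := by field_simp
  have h3 : ‖(F h ^ j) (g - ψ)‖ ≤ C * ‖g - ψ‖ := (F h ^ j).le_of_opNorm_le (hCi j le_rfl) _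
  rw [dist_eq_norm] at hgψ
  have h4 : (C + 1) * ‖g - ψ‖ ≤ ε / 2 := by
    calc (C + 1) * ‖g - ψ‖ ≤ (C + 1) * (ε / (2 * (C + 1))) := by gcongr
      _ = ε / 2 := by field_simp
  have h5 : (F h ^ j) g - g = (F h ^ j) (g - ψ) + ((F h ^ j) ψ - ψ) - (g - ψ) := by
    rw [map_sub]; abel
  rw [h5]
  have h6 := norm_sub_le ((F h ^ j) (g - ψ) + ((F h ^ j) ψ - ψ)) (g - ψ)
  have h7 := norm_add_le ((F h ^ j) (g - ψ)) ((F h ^ j) ψ - ψ)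
  linarith

/-- Affine approximation of `F(h)^k x` for two vectors `x`, `w` in the domain of `F'(0)`. -/
theorem IsChernoffFunction.eventually_norm_pow_sub_sub_le {F : ℝ≥0 → E →L[𝕜] E}
    (hF : IsChernoffFunction F) {x y w z : E} (hx : HasStrongDerivZero F x y)
    (hw : HasStrongDerivZero F w z) {C τ : ℝ} (hC1 : 0 ≤ C) (hτ : 0 ≤ τ)
    (hC : ∀ (h : ℝ≥0) (m : ℕ), (m * h : ℝ) ≤ τ → ‖F h ^ m‖ ≤ C) {c : ℝ}
    (hc : τ * (C * (‖y - w‖ + τ * ‖z‖)) < c) :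
    ∀ᶠ h : ℝ≥0 in 𝓝 0, ∀ k : ℕ, (k * h : ℝ) ≤ τ →
      ‖(F h ^ k) x - x - ((k * h : ℝ) : 𝕜) • w‖ ≤ c := by
  -- The strict inequality `hc` leaves room for the `o(h)` errors of both derivatives.
  obtain ⟨ε, hε, hεc⟩ : ∃ ε > 0, τ * (C * (‖y - w‖ + ε + τ * (‖z‖ + ε))) < c := by
    have : Tendsto (fun ε : ℝ => τ * (C * (‖y - w‖ + ε + τ * (‖z‖ + ε)))) (𝓝[>] 0)
        (𝓝 (τ * (C * (‖y - w‖ + 0 + τ * (‖z‖ + 0))))) :=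
      (Continuous.tendsto (by fun_prop) 0).mono_left nhdsWithin_le_nhds
    simp only [add_zero] at this
    obtain ⟨ε, h1, h2⟩ := ((this.eventually_lt_const hc).and self_mem_nhdsWithin).exists
    exact ⟨ε, h2, h1⟩
  filter_upwards [(hasStrongDerivZero_iff_eventually hF.map_zero).1 hx ε hε,
    hw.eventually_norm_le hF.map_zero hε] with h h1 h2 k hk
  have hCi : ∀ i ≤ k, ‖F h ^ i‖ ≤ C := fun i hi => hC h i (le_trans (by gcongr) hk)
  have h3 : ‖F h x - x - ((h : ℝ) : 𝕜) • w‖ ≤ h * (‖y - w‖ + ε) := by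
    have := norm_sub_le_norm_sub_add_norm_sub (F h x - x) (((h : ℝ) : 𝕜) • y) (((h : ℝ) : 𝕜) • w)
    rw [← smul_sub, norm_ofReal_coe_smul] at this
    linarith
  -- The model increment `h • w` drifts under `F h ^ j` by `O(τ)` relative to `h`, because `w` is
  -- itself in the domain of `F'(0)`.
  have h4 : ∀ j < k, ‖(F h ^ j) (((h : ℝ) : 𝕜) • w) - ((h : ℝ) : 𝕜) • w‖
      ≤ h * (τ * (C * (‖z‖ + ε))) := by
    intro j hj
    rw [map_smul, ← smul_sub, norm_ofReal_coe_smul]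
    gcongr
    calc _ ≤ (j : ℝ) * (C * ‖F h w - w‖) :=
          norm_pow_sub_le (F h) (fun i hi => hCi i (hi.trans hj).le) w
      _ ≤ j * (C * ((‖z‖ + ε) * h)) := by gcongr
      _ = (j * h) * (C * (‖z‖ + ε)) := by ring
      _ ≤ τ * (C * (‖z‖ + ε)) := by
        gcongr
        exact le_trans (by gcongr) hk
  have h5 := norm_pow_sub_sub_smul_le (F h) (fun i hi => hCi i hi.le) x _ h4
  have h6 : ((k * h : ℝ) : 𝕜) • w = (k : 𝕜) • ((h : ℝ) : 𝕜) • w := by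
    rw [smul_smul]; push_cast; rfl
  rw [h6]
  refine h5.trans (le_trans ?_ hεc.le)
  calc _ ≤ (k : ℝ) * (C * (h * (‖y - w‖ + ε)) + h * (τ * (C * (‖z‖ + ε)))) := by gcongr
    _ = (k * h) * (C * (‖y - w‖ + ε + τ * (‖z‖ + ε))) := by ring
    _ ≤ _ := by gcongr

end Chernoff

/-! ### Semigroups: Riemann sums, closed generators, cores. -/

section Semigroup

theorem exists_forall_le_of_eventually {p : ℝ≥0 → Prop} (h : ∀ᶠ s in 𝓝 (0 : ℝ≥0), p s) :
    ∃ δ : ℝ≥0, 0 < δ ∧ δ ≤ 1 ∧ ∀ s ≤ δ, p s := by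
  obtain ⟨δ, hδ, h⟩ := Metric.eventually_nhds_iff.1 h
  lift δ to ℝ≥0 using hδ.le
  have hδ' : 0 < δ := by exact_mod_cast hδ
  refine ⟨min 1 (δ / 2), by positivity, min_le_left _ _, fun s hs => h ?_⟩
  have h2 : s < δ := (hs.trans (min_le_right _ _)).trans_lt (half_lt_self hδ')
  rw [NNReal.dist_eq]
  simpa using h2

variable {𝕜 E : Type*} [RCLike 𝕜] [NormedAddCommGroup E] [NormedSpace 𝕜 E]
  {T : ℝ≥0 → E →L[𝕜] E}

namespace IsC0Semigroup

theorem map_natCast_mul (hT : IsC0Semigroup T) (s : ℝ≥0) (k : ℕ) : T (k * s) = T s ^ k := by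
  induction k with
  | zero => simp only [Nat.cast_zero, zero_mul, pow_zero]; exact hT.map_zero
  | succ k ih => rw [Nat.cast_succ, add_mul, one_mul, hT.map_add, ih, pow_succ]; rfl

theorem map_div_pow (hT : IsC0Semigroup T) (s : ℝ≥0) {k : ℕ} (hk : k ≠ 0) :
    T (s / k) ^ k = T s := by
  rw [← hT.map_natCast_mul, mul_div_cancel₀]
  exact_mod_cast hk

theorem map_add_apply (hT : IsC0Semigroup T) (l m : ℝ≥0) (x : E) : T (l + m) x = T l (T m x) := by
  rw [hT.map_add]; rfl

theorem map_zero_apply (hT : IsC0Semigroup T) (x : E) : T 0 x = x := by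
  rw [hT.map_zero]; rfl

theorem exists_norm_le (hT : IsC0Semigroup T) (τ : ℝ) :
    ∃ C : ℝ, 1 ≤ C ∧ ∀ s : ℝ≥0, (s : ℝ) ≤ τ → ‖T s‖ ≤ C := by
  obtain ⟨M, a, hM, h⟩ := hT.exp_bounded
  refine ⟨M * Real.exp (|a| * |τ|), ?_, fun s hs => (h s).trans ?_⟩
  · exact one_le_mul_of_one_le_of_one_le hM.le (Real.one_le_exp (by positivity))
  · gcongr
    · exact le_abs_self a
    · exact hs.trans (le_abs_self τ)

theorem eventually_norm_sub_le (hT : IsC0Semigroup T) (x : E) {ε : ℝ} (hε : 0 < ε) :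
    ∀ᶠ s in 𝓝 (0 : ℝ≥0), ‖T s x - x‖ ≤ ε := by
  have h := (hT.strongly_continuous x).tendsto 0
  rw [hT.map_zero_apply] at h
  filter_upwards [(Metric.tendsto_nhds.1 h) ε hε] with s hs
  rw [← dist_eq_norm]
  exact hs.le

theorem norm_pow_le (hT : IsC0Semigroup T) {C : ℝ} {s : ℝ≥0} (hC : ∀ r ≤ s, ‖T r‖ ≤ C)
    {k j : ℕ} (hj : j ≤ k) : ‖T (s / k) ^ j‖ ≤ C := by
  rw [← hT.map_natCast_mul]
  refine hC _ ?_
  rw [mul_div_left_comm]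
  refine mul_le_of_le_one_right' (div_le_one_of_le₀ (by exact_mod_cast hj) (by positivity))

/-- The Riemann sums of `∫₀ˢ T(r) g dr` converge to `T(s) f - f` if `g` is the generator
applied to `f`. -/
theorem eventually_norm_sub_sub_sum_le (hT : IsC0Semigroup T) {f g : E}
    (hf : HasStrongDerivZero T f g) (s : ℝ≥0) {ε : ℝ} (hε : 0 < ε) :
    ∀ᶠ k : ℕ in atTop, ‖T s f - f -
      ∑ j ∈ Finset.range k, (T (s / k) ^ j) ((((s / k : ℝ≥0) : ℝ) : 𝕜) • g)‖ ≤ s * ε := by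
  obtain ⟨C, hC1, hC⟩ := hT.exists_norm_le s
  have h0 : Tendsto (fun k : ℕ => s / (k : ℝ≥0)) atTop (𝓝 0) :=
    tendsto_const_div_atTop_nhds_zero_nat s
  filter_upwards [h0.eventually ((hasStrongDerivZero_iff_eventually hT.map_zero).1 hf (ε / C)
    (by positivity)), eventually_ne_atTop 0] with k hk hk0
  have h1 := norm_pow_sub_sub_sum_le (T (s / k)) (k := k) (C := C)
    (fun j hj => hT.norm_pow_le (fun r hr => hC r (by exact_mod_cast hr)) hj.le) f
    ((((s / k : ℝ≥0) : ℝ) : 𝕜) • g)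
  rw [hT.map_div_pow s hk0] at h1
  refine h1.trans ?_
  calc _ ≤ (k : ℝ) * (C * (ε / C * ((s / k : ℝ≥0) : ℝ))) := by gcongr
    _ = s * ε := by
      have : (k : ℝ) ≠ 0 := by exact_mod_cast hk0
      push_cast
      field_simp

/-- The left side is the norm of `∫₀ˢ (T(r)g - g) dr`, estimated through Riemann sums of ever finer
mesh. The bound involves `f` only through `g`, which is what makes the generator closed. -/
theorem norm_sub_sub_smul_le (hT : IsC0Semigroup T) {f g : E} (hf : HasStrongDerivZero T f g)
    {s : ℝ≥0} {ε : ℝ} (hε : ∀ r ≤ s, ‖T r g - g‖ ≤ ε) :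
    ‖T s f - f - ((s : ℝ) : 𝕜) • g‖ ≤ s * ε := by
  refine le_of_forall_pos_le_add fun η hη => ?_
  obtain ⟨k, hk, hk0⟩ := ((hT.eventually_norm_sub_sub_sum_le hf s
    (show 0 < η / (s + 1) by positivity)).and (eventually_ne_atTop 0)).exists
  have hk' : (k : ℝ) ≠ 0 := by exact_mod_cast hk0
  have hsk : ((s : ℝ) : 𝕜) • g =
      ∑ j ∈ Finset.range k, (((s / k : ℝ≥0) : ℝ) : 𝕜) • g := by
    rw [Finset.sum_const, Finset.card_range, ← Nat.cast_smul_eq_nsmul 𝕜, smul_smul]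
    congr 1
    have : (k : 𝕜) ≠ 0 := by exact_mod_cast hk0
    push_cast
    field_simp
  have h2 : ‖∑ j ∈ Finset.range k, (T (s / k) ^ j) ((((s / k : ℝ≥0) : ℝ) : 𝕜) • g) -
      ((s : ℝ) : 𝕜) • g‖ ≤ s * ε := by
    rw [hsk, ← Finset.sum_sub_distrib]
    calc _ ≤ ∑ j ∈ Finset.range k, ((s / k : ℝ≥0) : ℝ) * ε := by
          refine norm_sum_le_of_le _ fun j hj => ?_
          rw [map_smul, ← smul_sub, norm_ofReal_coe_smul, ← hT.map_natCast_mul]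
          gcongr
          refine hε _ ?_
          rw [mul_div_left_comm]
          refine mul_le_of_le_one_right' (div_le_one_of_le₀ ?_ (by positivity))
          exact_mod_cast (Finset.mem_range.1 hj).le
      _ = s * ε := by
        rw [Finset.sum_const, Finset.card_range, nsmul_eq_mul]
        push_cast
        field_simp
  have h3 : (s : ℝ) * (η / (s + 1)) ≤ η := by
    rw [mul_div_left_comm]
    exact mul_le_of_le_one_right hη.le (div_le_one_of_le₀ (by linarith) (by positivity))
  have h4 := norm_sub_le_norm_sub_add_norm_sub (T s f - f)
    (∑ j ∈ Finset.range k, (T (s / k) ^ j) ((((s / k : ℝ≥0) : ℝ) : 𝕜) • g))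
    (((s : ℝ) : 𝕜) • g)
  linarith

theorem hasStrongDerivZero_apply (hT : IsC0Semigroup T) {f g : E} (hf : HasStrongDerivZero T f g)
    (s : ℝ≥0) : HasStrongDerivZero T (T s f) (T s g) := by
  refine (((T s).continuous.tendsto g).comp hf).congr fun h => ?_
  simp only [Function.comp, map_smul, map_sub, ← hT.map_add_apply, add_comm]

/-- The bound of `norm_sub_sub_smul_le` is uniform along a convergent sequence in the graph, so it
passes to the limit and gives the expansion there. -/
theorem isClosed_strongDerivZero (hT : IsC0Semigroup T) : (strongDerivZero T).IsClosed := by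
  refine isClosed_of_closure_subset fun p hp => ?_
  obtain ⟨u, hu, hlim⟩ := mem_closure_iff_seq_limit.1 hp
  obtain ⟨f, g⟩ := p
  rw [nhds_prod_eq, tendsto_prod_iff'] at hlim
  obtain ⟨hl1, hl2⟩ := hlim
  refine mem_graph_strongDerivZero.2 ((hasStrongDerivZero_iff_eventually hT.map_zero).2 ?_)
  intro ε hε
  obtain ⟨C, hC1, hC⟩ := hT.exists_norm_le 1
  obtain ⟨δ, hδ, hδ1, hδg⟩ := exists_forall_le_of_eventually (hT.eventually_norm_sub_le g hε)
  filter_upwards [Iic_mem_nhds hδ] with s hs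
  have h1 : ∀ n, ‖T s (u n).1 - (u n).1 - ((s : ℝ) : 𝕜) • (u n).2‖ ≤
      s * ((C + 1) * ‖(u n).2 - g‖ + ε) := by
    intro n
    refine hT.norm_sub_sub_smul_le (mem_graph_strongDerivZero.1 (hu n)) fun r hr => ?_
    have h2 : T r (u n).2 - (u n).2 = T r ((u n).2 - g) - ((u n).2 - g) + (T r g - g) := by
      rw [map_sub]; abel
    have h3 : ‖T r ((u n).2 - g)‖ ≤ C * ‖(u n).2 - g‖ :=
      (T r).le_of_opNorm_le (hC r (by exact_mod_cast (hr.trans hs).trans hδ1)) _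
    rw [h2]
    refine (norm_add_le _ _).trans (add_le_add ((norm_sub_le _ _).trans ?_) (hδg r (hr.trans hs)))
    linarith
  have h4 : Tendsto (fun n => ‖T s (u n).1 - (u n).1 - ((s : ℝ) : 𝕜) • (u n).2‖) atTop
      (𝓝 ‖T s f - f - ((s : ℝ) : 𝕜) • g‖) :=
    (((((T s).continuous.tendsto f).comp hl1).sub hl1).sub (hl2.const_smul _)).norm
  have h5 : Tendsto (fun n => (s : ℝ) * ((C + 1) * ‖(u n).2 - g‖ + ε)) atTop
      (𝓝 (s * ((C + 1) * ‖g - g‖ + ε))) :=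
    ((((hl2.sub_const g).norm).const_mul _).add_const _).const_mul _
  have h6 := le_of_tendsto_of_tendsto' h4 h5 h1
  simpa [mul_comm] using h6

/-- A dense set of vectors whose orbits stay in the domain of a closed restriction of the
generator determines the generator. -/
theorem graph_strongDerivZero_le (hT : IsC0Semigroup T) {Γ : Submodule 𝕜 (E × E)}
    (hΓc : IsClosed (Γ : Set (E × E))) (hΓ : Γ ≤ (strongDerivZero T).graph) {A : Set E}
    (hA : Dense A) (hAΓ : ∀ f ∈ A, ∀ s, ∃ w, (T s f, w) ∈ Γ) :
    (strongDerivZero T).graph ≤ Γ := by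
  rintro ⟨x, y⟩ hxy
  rw [mem_graph_strongDerivZero] at hxy
  obtain ⟨C, hC1, hC⟩ := hT.exists_norm_le 1
  rw [← SetLike.mem_coe, ← hΓc.closure_eq]
  refine Metric.mem_closure_iff.2 fun ε₀ hε₀ => ?_
  obtain ⟨ε, hε, hεε⟩ : ∃ ε > 0, (C + 3) * ε < ε₀ :=
    ⟨ε₀ / (2 * (C + 3)), by positivity, by field_simp; linarith⟩
  obtain ⟨δ, hδ, hδ1, hδx⟩ := exists_forall_le_of_eventually
    ((hT.eventually_norm_sub_le x hε).and
      ((hasStrongDerivZero_iff_eventually hT.map_zero).1 hxy ε hε))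
  have hδ' : (0 : ℝ) < δ := hδ
  have hδ1' : (δ : ℝ) ≤ 1 := hδ1
  -- The extra factor `δ` survives the later division by `δ` in the second component.
  obtain ⟨f, hfA, hfx⟩ := Metric.mem_closure_iff.1 (hA x) (ε * δ) (by positivity)
  rw [dist_comm, dist_eq_norm] at hfx
  have horb : ∃ g, HasStrongDerivZero T f g ∧ ∀ s, (T s f, T s g) ∈ Γ := by
    obtain ⟨g, hg⟩ := hAΓ f hfA 0
    rw [hT.map_zero_apply] at hg
    have hg' := mem_graph_strongDerivZero.1 (hΓ hg)
    refine ⟨g, hg', fun s => ?_⟩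
    obtain ⟨w, hw⟩ := hAΓ f hfA s
    rwa [← (mem_graph_strongDerivZero.1 (hΓ hw)).unique (hT.hasStrongDerivZero_apply hg' s)]
  obtain ⟨g, hfg, hg⟩ := horb
  obtain ⟨k, hk, hk0⟩ := ((hT.eventually_norm_sub_sub_sum_le hfg δ hε).and
    (eventually_ne_atTop 0)).exists
  have hkR : (k : ℝ) ≠ 0 := by exact_mod_cast hk0
  have hk𝕜 : (k : 𝕜) ≠ 0 := by exact_mod_cast hk0
  have hCk : ∀ r ≤ δ, ‖T r‖ ≤ C := fun r hr => hC r (by exact_mod_cast hr.trans hδ1)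
  have hle : ∀ j < k, (j : ℝ≥0) * (δ / k) ≤ δ := by
    intro j hj
    rw [mul_div_left_comm]
    exact mul_le_of_le_one_right' (div_le_one_of_le₀ (by exact_mod_cast hj.le) (by positivity))
  -- A discrete form of `δ⁻¹ ∫₀^δ (T(r)f, T(r)g) dr`. The vector `g` need not be near `y`, but
  -- averaging turns the second component into a difference quotient of `f`, which is near that of
  -- `x`. Finite sums stay in `Γ` by linearity.
  let p : E × E := (k : 𝕜)⁻¹ • ∑ j ∈ Finset.range k, (T (j * (δ / k)) f, T (j * (δ / k)) g)
  have hp : p ∈ Γ := Γ.smul_mem _ (Γ.sum_mem fun j _ => hg _)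
  have hp1 : p.1 = (k : 𝕜)⁻¹ • ∑ j ∈ Finset.range k, T (j * (δ / k)) f := by
    simp [p, Prod.fst_sum]
  have hp2 : p.2 = (k : 𝕜)⁻¹ • ∑ j ∈ Finset.range k, T (j * (δ / k)) g := by
    simp [p, Prod.snd_sum]
  have hd1 : ‖x - p.1‖ ≤ (C + 3) * ε := by
    have h1 : x = (k : 𝕜)⁻¹ • ∑ j ∈ Finset.range k, x := by
      rw [Finset.sum_const, Finset.card_range, ← Nat.cast_smul_eq_nsmul 𝕜, inv_smul_smul₀ hk𝕜]
    rw [hp1]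
    nth_rw 1 [h1]
    rw [← smul_sub, ← Finset.sum_sub_distrib, norm_smul, norm_inv, RCLike.norm_natCast]
    have h2 : ‖∑ j ∈ Finset.range k, (x - T (j * (δ / k)) f)‖ ≤
        ∑ j ∈ Finset.range k, (C + 3) * ε := by
      refine norm_sum_le_of_le _ fun j hj => ?_
      have hj' := hle j (Finset.mem_range.1 hj)
      set r : ℝ≥0 := j * (δ / k)
      have h3 : ‖T r (f - x)‖ ≤ C * ‖f - x‖ := (T r).le_of_opNorm_le (hCk r hj') _
      have h4 : x - T r f = - (T r (f - x) + (T r x - x)) := by rw [map_sub]; abel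
      rw [h4, norm_neg]
      have h5 := norm_add_le (T r (f - x)) (T r x - x)
      have h6 := (hδx r hj').1
      have h7 : ‖f - x‖ ≤ ε := hfx.le.trans (mul_le_of_le_one_right hε.le hδ1')
      have h8 : C * ‖f - x‖ ≤ C * ε := by gcongr
      linarith
    calc _ ≤ (k : ℝ)⁻¹ * ∑ j ∈ Finset.range k, (C + 3) * ε := by gcongr
      _ = (C + 3) * ε := by
        rw [Finset.sum_const, Finset.card_range, nsmul_eq_mul, inv_mul_cancel_left₀ hkR]
  have hd2 : ‖y - p.2‖ ≤ (C + 3) * ε := by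
    have h1 : ((δ : ℝ) : 𝕜) • p.2 =
        ∑ j ∈ Finset.range k, (T (δ / k) ^ j) ((((δ / k : ℝ≥0) : ℝ) : 𝕜) • g) := by
      rw [hp2, smul_smul, Finset.smul_sum]
      refine Finset.sum_congr rfl fun j _ => ?_
      rw [map_smul, hT.map_natCast_mul]
      congr 1
      push_cast
      rw [div_eq_mul_inv]
    rw [← h1] at hk
    have h2 : ((δ : ℝ) : 𝕜) • (y - p.2) = (T δ f - f - ((δ : ℝ) : 𝕜) • p.2) -
        (T δ (f - x) - (f - x)) - (T δ x - x - ((δ : ℝ) : 𝕜) • y) := by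
      rw [smul_sub, map_sub]; abel
    have h3 : (δ : ℝ) * ‖y - p.2‖ ≤ δ * ((C + 3) * ε) := by
      rw [← norm_ofReal_coe_smul (𝕜 := 𝕜), h2]
      have h4 := norm_sub_le (T δ f - f - ((δ : ℝ) : 𝕜) • p.2 - (T δ (f - x) - (f - x)))
        (T δ x - x - ((δ : ℝ) : 𝕜) • y)
      have h5 := norm_sub_le (T δ f - f - ((δ : ℝ) : 𝕜) • p.2) (T δ (f - x) - (f - x))
      have h6 := norm_sub_le (T δ (f - x)) (f - x)
      have h7 : ‖T δ (f - x)‖ ≤ C * ‖f - x‖ := (T δ).le_of_opNorm_le (hCk δ le_rfl) _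
      have h8 : (C + 1) * ‖f - x‖ ≤ (C + 1) * (ε * δ) := by gcongr
      have h9 := (hδx δ le_rfl).2
      linarith
    exact le_of_mul_le_mul_left h3 hδ'
  refine ⟨p, hp, lt_of_le_of_lt ?_ hεε⟩
  rw [dist_eq_norm, Prod.norm_def]
  exact max_le hd1 hd2

end IsC0Semigroup

end Semigroup

/-! ### Chernoff's product formula. -/

section ChernoffApproximation

variable {𝕜 E : Type*} [RCLike 𝕜] [NormedAddCommGroup E] [NormedSpace 𝕜 E]
  {F T : ℝ≥0 → E →L[𝕜] E}

theorem natFloor_mul_mul_div_le (t s : ℝ≥0) (n : ℕ) :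
    (⌊(n : ℝ≥0) * s⌋₊ : ℝ≥0) * (t / n) ≤ t * s := by
  rcases Nat.eq_zero_or_pos n with rfl | hn
  · simp
  · have hn' : (n : ℝ≥0) ≠ 0 := by exact_mod_cast hn.ne'
    calc (⌊(n : ℝ≥0) * s⌋₊ : ℝ≥0) * (t / n) ≤ (n * s) * (t / n) := by
          gcongr
          exact Nat.floor_le (by positivity)
      _ = t * s := by field_simp

theorem tendsto_natFloor_mul_mul_div (t s : ℝ≥0) :
    Tendsto (fun n : ℕ => (⌊(n : ℝ≥0) * s⌋₊ : ℝ≥0) * (t / n)) atTop (𝓝 (t * s)) := by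
  have h : Tendsto (fun x : ℝ => (⌊(s : ℝ) * x⌋₊ : ℝ) / x) atTop (𝓝 s) :=
    tendsto_nat_floor_mul_div_atTop s.2
  refine NNReal.tendsto_coe.1 ?_
  rw [NNReal.coe_mul]
  refine ((h.comp tendsto_natCast_atTop_atTop).const_mul (t : ℝ)).congr fun n => ?_
  have h1 : ⌊(s : ℝ) * n⌋₊ = ⌊(n : ℝ≥0) * s⌋₊ := by
    rw [mul_comm, ← NNReal.coe_natCast, ← NNReal.coe_mul]; exact Nonneg.nat_floor_coe _
  simp only [Function.comp, h1]
  push_cast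
  ring

/-- One macroscopic step of length `δ`. The slope `w` is the secant from `p.1` to `q.1`, so the
affine approximation ends at `q.1`; by linearity `w` is in the domain of `F'(0)`, with derivative
`z`. -/
theorem IsChernoffFunction.eventually_norm_pow_sub_le_of_mem_graph (hF : IsChernoffFunction F)
    {p q : E × E} (hp : p ∈ (strongDerivZero F).graph) (hq : q ∈ (strongDerivZero F).graph)
    {δ : ℝ≥0} (hδ : 0 < δ) {C : ℝ} (hC0 : 0 ≤ C)
    (hC : ∀ (h : ℝ≥0) (m : ℕ), (m * h : ℝ) ≤ δ → ‖F h ^ m‖ ≤ C)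
    {h : ℕ → ℝ≥0} {k : ℕ → ℕ} (hh : Tendsto h atTop (𝓝 0)) (hkh : ∀ n, k n * h n ≤ δ)
    (hlim : Tendsto (fun n => (k n : ℝ≥0) * h n) atTop (𝓝 δ)) {c : ℝ}
    (hc : C * (‖((δ : ℝ) : 𝕜) • p.2 - (q.1 - p.1)‖ + δ * ‖q.2 - p.2‖) < c) :
    ∀ᶠ n in atTop, ‖(F (h n) ^ k n) p.1 - q.1‖ ≤ c := by
  obtain ⟨c', hc', hcc⟩ := exists_between hc
  rw [mem_graph_strongDerivZero] at hp hq
  have hδ' : ((δ : ℝ) : 𝕜) ≠ 0 := by simpa using hδ.ne'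
  have hδR : (0 : ℝ) < δ := hδ
  set w : E := ((δ : ℝ) : 𝕜)⁻¹ • (q.1 - p.1) with hw
  set z : E := ((δ : ℝ) : 𝕜)⁻¹ • (q.2 - p.2) with hz
  have hδw : ((δ : ℝ) : 𝕜) • w = q.1 - p.1 := smul_inv_smul₀ hδ' _
  have hδz : ((δ : ℝ) : 𝕜) • z = q.2 - p.2 := smul_inv_smul₀ hδ' _
  have hwz : HasStrongDerivZero F w z := by
    have := (hq.add (hp.smul (-1 : 𝕜))).smul ((δ : ℝ) : 𝕜)⁻¹
    simpa only [neg_smul, one_smul, ← sub_eq_add_neg] using this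
  have hlt : (δ : ℝ) * (C * (‖p.2 - w‖ + δ * ‖z‖)) < c' := by
    rw [← hδw, ← hδz, ← smul_sub, norm_ofReal_coe_smul, norm_ofReal_coe_smul] at hc'
    linarith
  have hlim' : Tendsto (fun n => ((k n * h n : ℝ) : 𝕜) • w) atTop (𝓝 (q.1 - p.1)) := by
    rw [← hδw]
    refine Tendsto.smul_const ?_ w
    have h1 : Tendsto (fun n => (((k n : ℝ≥0) * h n : ℝ≥0) : ℝ)) atTop (𝓝 δ) :=
      NNReal.tendsto_coe.2 hlim
    have h2 := (RCLike.continuous_ofReal (K := 𝕜)).tendsto (δ : ℝ)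
    simpa [Function.comp_def] using h2.comp h1
  filter_upwards [hh.eventually (hF.eventually_norm_pow_sub_sub_le hp hwz hC0 hδR.le hC hlt),
    (Metric.tendsto_nhds.1 hlim') (c - c') (by linarith)] with n h1 h2
  have h3 := h1 (k n) (by exact_mod_cast hkh n)
  rw [dist_eq_norm] at h2
  have h4 := norm_add_le ((F (h n) ^ k n) p.1 - p.1 - ((k n * h n : ℝ) : 𝕜) • w)
    (((k n * h n : ℝ) : 𝕜) • w - (q.1 - p.1))
  have h5 : (F (h n) ^ k n) p.1 - p.1 - ((k n * h n : ℝ) : 𝕜) • w +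
    (((k n * h n : ℝ) : 𝕜) • w - (q.1 - p.1)) = (F (h n) ^ k n) p.1 - q.1 := by abel
  rw [h5] at h4
  linarith

/-- The hypothesis `hc` is an open condition on `(p, q)`, so both may be moved into the graph; the
last two terms of `Ψ` pay for the move. -/
theorem IsChernoffFunction.eventually_norm_pow_sub_le_of_mem_closure (hF : IsChernoffFunction F)
    {p q : E × E} (hp : p ∈ closure ((strongDerivZero F).graph : Set (E × E)))
    (hq : q ∈ closure ((strongDerivZero F).graph : Set (E × E)))
    {δ : ℝ≥0} (hδ : 0 < δ) {C : ℝ} (hC0 : 0 ≤ C)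
    (hC : ∀ (h : ℝ≥0) (m : ℕ), (m * h : ℝ) ≤ δ → ‖F h ^ m‖ ≤ C)
    {h : ℕ → ℝ≥0} {k : ℕ → ℕ} (hh : Tendsto h atTop (𝓝 0)) (hkh : ∀ n, k n * h n ≤ δ)
    (hlim : Tendsto (fun n => (k n : ℝ≥0) * h n) atTop (𝓝 δ)) {c : ℝ}
    (hc : C * (‖((δ : ℝ) : 𝕜) • p.2 - (q.1 - p.1)‖ + δ * ‖q.2 - p.2‖) < c) :
    ∀ᶠ n in atTop, ‖(F (h n) ^ k n) p.1 - q.1‖ ≤ c := by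
  let Ψ : (E × E) × (E × E) → ℝ := fun r =>
    C * (‖((δ : ℝ) : 𝕜) • r.1.2 - (r.2.1 - r.1.1)‖ + δ * ‖r.2.2 - r.1.2‖) +
      C * ‖p.1 - r.1.1‖ + ‖r.2.1 - q.1‖
  have hΨ : Continuous Ψ := by fun_prop
  have hΨc : Ψ (p, q) < c := by simpa [Ψ] using hc
  have hmem : (p, q) ∈ closure (((strongDerivZero F).graph : Set (E × E)) ×ˢ
      ((strongDerivZero F).graph : Set (E × E))) := by
    rw [closure_prod_eq]; exact ⟨hp, hq⟩
  obtain ⟨⟨p', q'⟩, hr, hp', hq'⟩ := mem_closure_iff_nhds.1 hmem _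
    (hΨ.continuousAt.eventually_lt_const hΨc)
  have hr' : Ψ (p', q') < c := hr
  simp only [Ψ] at hr'
  filter_upwards [hF.eventually_norm_pow_sub_le_of_mem_graph hp' hq' hδ hC0 hC hh hkh hlim
    (c := c - C * ‖p.1 - p'.1‖ - ‖q'.1 - q.1‖) (by linarith)] with n hn
  have h1 : ‖(F (h n) ^ k n) (p.1 - p'.1)‖ ≤ C * ‖p.1 - p'.1‖ :=
    (F (h n) ^ k n).le_of_opNorm_le (hC _ _ (by exact_mod_cast hkh n)) _
  have h2 : (F (h n) ^ k n) p.1 - q.1 = (F (h n) ^ k n) (p.1 - p'.1) +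
      ((F (h n) ^ k n) p'.1 - q'.1) + (q'.1 - q.1) := by rw [map_sub]; abel
  rw [h2]
  exact (norm_add₃_le).trans (by linarith)

/-- Telescoping bound for the `N`-th power of an operator along a chain of vectors. -/
theorem norm_pow_mul_sub_le (L : E →L[𝕜] E) (x : ℕ → E) {k N : ℕ} {C c : ℝ}
    (hC : ∀ m ≤ N * k, ‖L ^ m‖ ≤ C) (hC0 : 0 ≤ C) (hx : ∀ i < N, ‖(L ^ k) (x i) - x (i + 1)‖ ≤ c) :
    ‖(L ^ (N * k)) (x 0) - x N‖ ≤ N * (C * c) := by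
  have h := dist_le_range_sum_of_dist_le (f := fun i => (L ^ ((N - i) * k)) (x i)) N
    (d := fun _ => C * c) (fun {i} hi => ?_)
  · simpa [dist_eq_norm] using h
  · have h1 : N - i = (N - (i + 1)) + 1 := by omega
    rw [dist_eq_norm, h1, add_mul, one_mul, pow_add, mul_apply_eq_comp, ← map_sub]
    refine ((L ^ _).le_of_opNorm_le (hC _ (by gcongr; omega)) _).trans ?_
    gcongr
    exact hx i hi

/-- Chernoff's product formula on the domain of the generator. -/
theorem IsChernoffFunction.tendsto_pow_apply (hF : IsChernoffFunction F) (hT : IsC0Semigroup T)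
    (hFT : ((strongDerivZero T).graph : Set (E × E)) ⊆
      closure ((strongDerivZero F).graph : Set (E × E)))
    {f g : E} (hf : HasStrongDerivZero T f g) {t : ℝ≥0} (ht : 0 < t) (s : ℝ≥0) :
    Tendsto (fun n : ℕ => (F (t / n) ^ ⌊(n : ℝ≥0) * s⌋₊) f) atTop (𝓝 (T (t * s) f)) := by
  rcases eq_or_ne s 0 with rfl | hs
  · simp [hT.map_zero_apply]
  have hs0 : 0 < s := pos_iff_ne_zero.2 hs
  obtain ⟨C, hC1, hC⟩ := hF.exists_norm_pow_le_of_le (t * s : ℝ≥0)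
  obtain ⟨D, hD1, hD⟩ := hT.exists_norm_le (t * s : ℝ≥0)
  refine Metric.tendsto_nhds.2 fun ε hε => ?_
  -- Each of `N` macroscopic steps costs `3CDδη`, stability adds a factor `C`, and `Nδ = ts`.
  obtain ⟨η, hη, hηε⟩ : ∃ η > 0, 3 * C ^ 2 * D * (t * s : ℝ≥0) * η = ε / 3 :=
    ⟨ε / 3 / (3 * C ^ 2 * D * (t * s : ℝ≥0)), by positivity, by field_simp⟩
  obtain ⟨δ₀, hδ₀, -, hδ₀f⟩ := exists_forall_le_of_eventually
    (((hasStrongDerivZero_iff_eventually hT.map_zero).1 hf η hη).and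
      (hT.eventually_norm_sub_le g hη))
  obtain ⟨N, hNδ, hN0⟩ := (((tendsto_const_div_atTop_nhds_zero_nat (t * s)).eventually
    (Iic_mem_nhds hδ₀)).and (eventually_ne_atTop 0)).exists
  have hN0' : (N : ℝ≥0) ≠ 0 := by exact_mod_cast hN0
  have hN0R : (N : ℝ) ≠ 0 := by exact_mod_cast hN0
  set δ : ℝ≥0 := t * (s / N) with hδdef
  have hNδ' : (N : ℝ≥0) * δ = t * s := by rw [hδdef]; field_simp
  have hδδ₀ : δ ≤ δ₀ := by rw [hδdef, ← mul_div_assoc]; exact hNδ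
  have hδ : 0 < δ := by positivity
  have hδR : (0 : ℝ) < δ := hδ
  have hδle : δ ≤ t * s := by
    rw [← hNδ']
    exact le_mul_of_one_le_left' (by exact_mod_cast Nat.one_le_iff_ne_zero.2 hN0)
  have hh : Tendsto (fun n : ℕ => t / (n : ℝ≥0)) atTop (𝓝 0) :=
    tendsto_const_div_atTop_nhds_zero_nat t
  have hstep : ∀ i ∈ Finset.range N, ∀ᶠ n : ℕ in atTop,
      ‖(F (t / n) ^ ⌊(n : ℝ≥0) * (s / N)⌋₊) (T (i * δ) f) - T ((i + 1 : ℕ) * δ) f‖ ≤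
        3 * C * D * δ * η := by
    intro i hi
    have hiδ : ‖T (i * δ)‖ ≤ D := by
      refine hD _ (NNReal.coe_le_coe.2 ?_)
      rw [← hNδ']
      gcongr
      exact (Finset.mem_range.1 hi).le
    have hsucc : ∀ v, T ((i + 1 : ℕ) * δ) v = T (i * δ) (T δ v) := fun v => by
      rw [← hT.map_add_apply]; congr 2; push_cast; ring
    -- The endpoints lie on the exact orbit. Factoring out `T (i * δ)` reduces both errors to time
    -- `0`, at the price of `D`.
    refine hF.eventually_norm_pow_sub_le_of_mem_closure (p := (T (i * δ) f, T (i * δ) g))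
      (q := (T ((i + 1 : ℕ) * δ) f, T ((i + 1 : ℕ) * δ) g))
      (hFT (mem_graph_strongDerivZero.2 (hT.hasStrongDerivZero_apply hf _)))
      (hFT (mem_graph_strongDerivZero.2 (hT.hasStrongDerivZero_apply hf _)))
      hδ (zero_le_one.trans hC1)
      (fun h m hm => hC h m (hm.trans (NNReal.coe_le_coe.2 hδle))) hh
      (fun n => natFloor_mul_mul_div_le t (s / N) n) (tendsto_natFloor_mul_mul_div t (s / N)) ?_
    have h1 : ‖((δ : ℝ) : 𝕜) • T (i * δ) g - (T ((i + 1 : ℕ) * δ) f - T (i * δ) f)‖ ≤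
        D * (η * δ) := by
      rw [hsucc, norm_sub_rev, ← map_smul, ← map_sub, ← map_sub]
      exact (T _).le_of_opNorm_le_of_le hiδ (hδ₀f δ hδδ₀).1
    have h2 : ‖T ((i + 1 : ℕ) * δ) g - T (i * δ) g‖ ≤ D * η := by
      rw [hsucc, ← map_sub]
      exact (T _).le_of_opNorm_le_of_le hiδ (hδ₀f δ hδδ₀).2
    calc _ ≤ C * (D * (η * δ) + δ * (D * η)) := by dsimp only; gcongr
      _ = 2 * C * D * δ * η := by ring
      _ < _ := by gcongr; norm_num
  -- Rounding leaves at most `N` of the `⌊ns⌋` factors over; their total time `Nt/n` tends to `0`,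
  -- so they barely move `f`.
  obtain ⟨ρ, hρ, hρf⟩ := hF.exists_forall_norm_pow_sub_le f (ε := ε / (3 * C)) (by positivity)
  have hNh : Tendsto (fun n : ℕ => ((N : ℝ≥0) * (t / n) : ℝ≥0).1) atTop (𝓝 0) := by
    have := NNReal.tendsto_coe.2 (hh.const_mul (N : ℝ≥0))
    simpa using this
  filter_upwards [(Filter.eventually_all_finset _).2 hstep, hh.eventually hρf,
    hNh.eventually (Iic_mem_nhds hρ)] with n h1 h2 h3
  set L := F (t / n)
  set k := ⌊(n : ℝ≥0) * (s / N)⌋₊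
  set m := ⌊(n : ℝ≥0) * s⌋₊
  have hkm : N * k ≤ m := by
    refine Nat.le_floor ?_
    push_cast
    calc (N : ℝ≥0) * k ≤ N * (n * (s / N)) := by
          gcongr
          exact Nat.floor_le (by positivity)
      _ = n * s := by field_simp
  have hmk : m ≤ N * k + N := by
    refine Nat.floor_le_of_le ?_
    push_cast
    calc (n : ℝ≥0) * s = N * (n * (s / N)) := by field_simp
      _ ≤ N * (k + 1) := by
        gcongr
        exact (Nat.lt_floor_add_one _).le
      _ = _ := by ring
  have hLm : ∀ j ≤ m, ‖L ^ j‖ ≤ C := by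
    intro j hj
    refine hC _ _ ?_
    have h5 : (j : ℝ≥0) * (t / n) ≤ t * s :=
      le_trans (by gcongr) (natFloor_mul_mul_div_le t s n)
    exact_mod_cast h5
  have h6 : ‖(L ^ (N * k)) f - T (t * s) f‖ ≤ ε / 3 := by
    have := norm_pow_mul_sub_le L (fun i => T (i * δ) f) (k := k) (N := N) (C := C)
      (fun j hj => hLm j (hj.trans hkm)) (zero_le_one.trans hC1)
      (fun i hi => h1 i (Finset.mem_range.2 hi))
    simp only [Nat.cast_zero, zero_mul, hT.map_zero_apply, hNδ'] at this
    refine this.trans (le_of_eq ?_)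
    rw [← hηε, ← hNδ']
    push_cast
    ring
  have h7 : ‖(L ^ m) f - (L ^ (N * k)) f‖ ≤ ε / 3 := by
    obtain ⟨r, hr⟩ := Nat.exists_eq_add_of_le hkm
    have hr' : r ≤ N := by omega
    rw [hr, pow_add, mul_apply_eq_comp, ← map_sub]
    have h8 : ‖(L ^ r) f - f‖ ≤ ε / (3 * C) := by
      refine h2 r (le_trans ?_ h3)
      have : (r : ℝ≥0) * (t / n) ≤ N * (t / n) := by gcongr
      exact_mod_cast this
    refine ((L ^ (N * k)).le_of_opNorm_le_of_le (hLm _ hkm) h8).trans (le_of_eq ?_)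
    field_simp
  rw [dist_eq_norm]
  have h9 := norm_sub_le_norm_sub_add_norm_sub ((L ^ m) f) ((L ^ (N * k)) f) (T (t * s) f)
  linarith

end ChernoffApproximation

/-! ### The semigroup obtained as a limit of Chernoff iterates. -/

section LimitSemigroup

variable {𝕜 E : Type*} [RCLike 𝕜] [NormedAddCommGroup E] [NormedSpace 𝕜 E]
  {F T : ℝ≥0 → E →L[𝕜] E}

/-- Writing `T(r+d)x - T(r)x = T(r)(T(d)x - x)` with `r` the smaller of the two times treats left
and right continuity alike. -/
theorem continuous_of_eventually_norm_sub_le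
    (hadd : ∀ l m x, T (l + m) x = T l (T m x))
    (hbdd : ∀ τ : ℝ≥0, ∃ C : ℝ, 0 ≤ C ∧ ∀ s ≤ τ, ‖T s‖ ≤ C)
    (hcont : ∀ x, ∀ ε > 0, ∃ δ > 0, ∀ s : ℝ≥0, (s : ℝ) ≤ δ → ‖T s x - x‖ ≤ ε) (x : E) :
    Continuous fun s => T s x := by
  refine Metric.continuous_iff.2 fun s ε hε => ?_
  obtain ⟨C, hC0, hC⟩ := hbdd (s + 1)
  obtain ⟨δ, hδ, h⟩ := hcont x (ε / (2 * (C + 1))) (by positivity)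
  have key : ∀ r d : ℝ≥0, r ≤ s + 1 → (d : ℝ) ≤ δ → dist (T (r + d) x) (T r x) < ε := by
    intro r d hr hd
    rw [dist_eq_norm, hadd, ← map_sub]
    refine ((T r).le_of_opNorm_le_of_le (hC r hr) (h d hd)).trans_lt ?_
    rw [mul_div_assoc', div_lt_iff₀ (by positivity)]
    nlinarith
  refine ⟨min δ 1, by positivity, fun r hr => ?_⟩
  rcases le_total r s with hrs | hrs
  · obtain ⟨d, rfl⟩ := exists_add_of_le hrs
    have hd : (d : ℝ) < min δ 1 := by simpa [NNReal.dist_eq] using hr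
    rw [dist_comm]
    exact key r d (hrs.trans (le_add_of_nonneg_right zero_le)) (hd.le.trans (min_le_left _ _))
  · obtain ⟨d, rfl⟩ := exists_add_of_le hrs
    have hd : (d : ℝ) < min δ 1 := by simpa [NNReal.dist_eq] using hr
    exact key s d (le_add_of_nonneg_right zero_le) (hd.le.trans (min_le_left _ _))

/-- Strong convergence of uniformly bounded operators extends from a dense set. -/
theorem exists_tendsto_of_dense [CompleteSpace E] {ι : Type*} {l : Filter ι} [l.NeBot]
    {V : ι → E →L[𝕜] E} {C : ℝ} (hC0 : 0 ≤ C) (hC : ∀ n, ‖V n‖ ≤ C) {A : Set E} (hA : Dense A)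
    (h : ∀ f ∈ A, ∃ y, Tendsto (fun n => V n f) l (𝓝 y)) (f : E) :
    ∃ y, Tendsto (fun n => V n f) l (𝓝 y) := by
  refine cauchy_map_iff_exists_tendsto.1 (Metric.cauchy_iff.2 ⟨inferInstance, fun ε hε => ?_⟩)
  obtain ⟨f', hf', hd⟩ := Metric.mem_closure_iff.1 (hA f) (ε / (4 * (C + 1))) (by positivity)
  obtain ⟨y, hy⟩ := h f' hf'
  refine ⟨Metric.ball y (ε / 2), ?_, fun a ha b hb => ?_⟩
  · refine mem_map.2 ?_
    filter_upwards [(Metric.tendsto_nhds.1 hy) (ε / 4) (by positivity)] with n hn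
    rw [dist_eq_norm] at hd
    have h1 : dist (V n f) (V n f') ≤ ε / 4 := by
      rw [dist_eq_norm, ← map_sub]
      refine ((V n).le_of_opNorm_le_of_le (hC n) hd.le).trans ?_
      rw [mul_div_assoc', div_le_div_iff₀ (by positivity) (by positivity)]
      nlinarith
    have h2 := dist_triangle (V n f) (V n f') y
    rw [mem_preimage, Metric.mem_ball]
    linarith
  · have := dist_triangle_right a b y
    rw [Metric.mem_ball] at ha hb
    linarith

theorem exists_clm_of_tendsto {ι : Type*} {l : Filter ι} [l.NeBot]
    {V : ι → E →L[𝕜] E} {C : ℝ} (hC : ∀ n, ‖V n‖ ≤ C)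
    (h : ∀ f, ∃ y, Tendsto (fun n => V n f) l (𝓝 y)) :
    ∃ S : E →L[𝕜] E, (∀ f, Tendsto (fun n => V n f) l (𝓝 (S f))) ∧ ∀ f, ‖S f‖ ≤ C * ‖f‖ := by
  choose φ hφ using h
  have hb : ∀ f, ‖φ f‖ ≤ C * ‖f‖ := fun f =>
    le_of_tendsto' (hφ f).norm fun n => (V n).le_of_opNorm_le (hC n) f
  exact ⟨LinearMap.mkContinuous (linearMapOfTendsto φ (fun n => (V n : E →ₗ[𝕜] E))
    (tendsto_pi_nhds.2 hφ)) C hb, hφ, hb⟩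

/-- If the Chernoff iterates converge strongly on a dense set along a filter finer than `atTop`,
then the limit is a `C₀`-semigroup whose generator extends `F'(0)`. -/
theorem IsChernoffFunction.exists_isC0Semigroup [CompleteSpace E] (hF : IsChernoffFunction F)
    {l : Filter ℕ} [l.NeBot] (hl : l ≤ atTop) {t : ℝ≥0} (ht : 0 < t) {A : Set E} (hA : Dense A)
    (h : ∀ f ∈ A, ∀ s : ℝ≥0, ∃ y,
      Tendsto (fun n : ℕ => (F (t / n) ^ ⌊(n : ℝ≥0) * s⌋₊) f) l (𝓝 y)) :
    ∃ T : ℝ≥0 → E →L[𝕜] E, IsC0Semigroup T ∧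
      (∀ s f, Tendsto (fun n : ℕ => (F (t / n) ^ ⌊(n : ℝ≥0) * (s / t)⌋₊) f) l (𝓝 (T s f))) ∧
      ∀ f y, HasStrongDerivZero F f y → HasStrongDerivZero T f y := by
  obtain ⟨M, ω, hM, hω, hMω⟩ := hF.exists_norm_pow_le
  have hts : ∀ s : ℝ≥0, t * (s / t) = s := fun s => mul_div_cancel₀ s ht.ne'
  have hle : ∀ (s : ℝ≥0) (n : ℕ), (⌊(n : ℝ≥0) * (s / t)⌋₊ : ℝ≥0) * (t / n) ≤ s := fun s n =>
    (natFloor_mul_mul_div_le t (s / t) n).trans_eq (hts s)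
  have hleR : ∀ (s : ℝ≥0) (n : ℕ),
      (⌊(n : ℝ≥0) * (s / t)⌋₊ : ℝ) * ((t / n : ℝ≥0) : ℝ) ≤ s := fun s n => by
    exact_mod_cast hle s n
  have hh : Tendsto (fun n : ℕ => t / (n : ℝ≥0)) l (𝓝 0) :=
    (tendsto_const_div_atTop_nhds_zero_nat t).mono_left hl
  have hb : ∀ (s : ℝ≥0) (n : ℕ),
      ‖F (t / n) ^ ⌊(n : ℝ≥0) * (s / t)⌋₊‖ ≤ M * Real.exp (ω * s) := fun s n =>
    (hMω _ _).trans (by gcongr; exact hleR s n)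
  choose T hT hTb using fun s => exists_clm_of_tendsto (hb s)
    (exists_tendsto_of_dense (by positivity) (hb s) hA fun f hf => h f hf (s / t))
  have hTn : ∀ s, ‖T s‖ ≤ M * Real.exp (ω * s) := fun s =>
    ContinuousLinearMap.opNorm_le_bound _ (by positivity) (hTb s)
  have h0 : ∀ x, T 0 x = x := fun x =>
    tendsto_nhds_unique (hT 0 x) (by simp)
  have hsmall : ∀ x, ∀ ε > 0, ∃ δ > 0, ∀ s : ℝ≥0, (s : ℝ) ≤ δ → ‖T s x - x‖ ≤ ε := by
    intro x ε hε
    obtain ⟨δ, hδ, hx⟩ := hF.exists_forall_norm_pow_sub_le x hε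
    refine ⟨δ, hδ, fun s hs => le_of_tendsto ((hT s x).sub_const x).norm ?_⟩
    filter_upwards [hh.eventually hx] with n hn
    exact hn _ ((hleR s n).trans hs)
  have hadd : ∀ a b x, T (a + b) x = T a (T b x) := by
    intro a b x
    have h1 : Tendsto (fun n : ℕ => (F (t / n) ^ ⌊(n : ℝ≥0) * (a / t)⌋₊)
        ((F (t / n) ^ ⌊(n : ℝ≥0) * (b / t)⌋₊) x)) l (𝓝 (T a (T b x))) := by
      rw [tendsto_iff_norm_sub_tendsto_zero]
      have h2 : Tendsto (fun n : ℕ => M * Real.exp (ω * a) *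
          ‖(F (t / n) ^ ⌊(n : ℝ≥0) * (b / t)⌋₊) x - T b x‖ +
          ‖(F (t / n) ^ ⌊(n : ℝ≥0) * (a / t)⌋₊) (T b x) - T a (T b x)‖) l (𝓝 0) := by
        simpa using ((tendsto_iff_norm_sub_tendsto_zero.1 (hT b x)).const_mul
          (M * Real.exp (ω * a))).add (tendsto_iff_norm_sub_tendsto_zero.1 (hT a (T b x)))
      refine squeeze_zero (fun _ => norm_nonneg _) (fun n => ?_) h2
      refine (norm_sub_le_norm_sub_add_norm_sub _
        ((F (t / n) ^ ⌊(n : ℝ≥0) * (a / t)⌋₊) (T b x)) _).trans ?_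
      gcongr
      rw [← map_sub]
      exact ContinuousLinearMap.le_of_opNorm_le _ (hb a n) _
    refine tendsto_nhds_unique (hT (a + b) x) ?_
    rw [← sub_zero (T a (T b x))]
    refine (h1.sub (b := 0) (g := fun n : ℕ => (F (t / n) ^ ⌊(n : ℝ≥0) * (a / t)⌋₊)
        ((F (t / n) ^ ⌊(n : ℝ≥0) * (b / t)⌋₊) x) -
        (F (t / n) ^ ⌊(n : ℝ≥0) * ((a + b) / t)⌋₊) x) ?_).congr fun n => by abel
    -- The integer parts for `a` and `b` add up to that for `a + b` or one less, so the discrepancy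
    -- is at most one factor `F(t/n)` acting near the identity.
    refine Metric.tendsto_nhds.2 fun ε hε => ?_
    obtain ⟨C, hC1, hC⟩ := hF.exists_norm_pow_le_of_le (a + b : ℝ≥0)
    obtain ⟨δ, hδ, hx⟩ := hF.exists_forall_norm_pow_sub_le x (ε := ε / (2 * C)) (by positivity)
    have hhδ : ∀ᶠ n : ℕ in l, ((t / n : ℝ≥0) : ℝ) ≤ δ := by
      have := NNReal.tendsto_coe.2 hh
      exact this.eventually (Iic_mem_nhds hδ)
    filter_upwards [hh.eventually hx, hhδ] with n hn hnδ
    set L := F (t / n)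
    set i := ⌊(n : ℝ≥0) * (a / t)⌋₊
    set j := ⌊(n : ℝ≥0) * (b / t)⌋₊
    set m := ⌊(n : ℝ≥0) * ((a + b) / t)⌋₊ with hm
    have hm' : m = ⌊(n : ℝ≥0) * (a / t) + n * (b / t)⌋₊ := by rw [hm, add_div, mul_add]
    have hijm : i + j ≤ m := by
      rw [hm']
      refine Nat.le_floor ?_
      push_cast
      exact add_le_add (Nat.floor_le (by positivity)) (Nat.floor_le (by positivity))
    have hmij : m ≤ i + j + 1 := by
      rw [hm', ← Nat.lt_succ_iff, Nat.floor_lt (by positivity)]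
      push_cast
      have h3 := Nat.lt_floor_add_one ((n : ℝ≥0) * (a / t))
      have h4 := Nat.lt_floor_add_one ((n : ℝ≥0) * (b / t))
      calc _ < ((i : ℝ≥0) + 1) + (j + 1) := add_lt_add h3 h4
        _ = _ := by ring
    obtain ⟨r, hr⟩ := Nat.exists_eq_add_of_le hijm
    have hr1 : r ≤ 1 := by omega
    have hr2 : ‖(L ^ r) x - x‖ ≤ ε / (2 * C) := by
      refine hn r (le_trans ?_ hnδ)
      exact mul_le_of_le_one_left (NNReal.coe_nonneg _) (by exact_mod_cast hr1)
    have hij : ‖L ^ (i + j)‖ ≤ C := by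
      refine hC _ _ (le_trans ?_ (hleR (a + b) n))
      gcongr
    have h5 : (L ^ i) ((L ^ j) x) - (L ^ m) x = -(L ^ (i + j)) ((L ^ r) x - x) := by
      rw [hr, pow_add L (i + j), mul_apply_eq_comp, map_sub, pow_add, mul_apply_eq_comp,
        mul_apply_eq_comp]
      abel
    rw [dist_zero_right, h5, norm_neg]
    refine (ContinuousLinearMap.le_of_opNorm_le_of_le _ hij hr2).trans_lt ?_
    field_simp
    norm_num
  have hcont := continuous_of_eventually_norm_sub_le hadd
    (fun τ => ⟨M * Real.exp (ω * τ), by positivity, fun s hs => (hTn s).trans (by gcongr)⟩) hsmall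
  -- `M + 1` because the definition asks for a constant strictly above `1`.
  refine ⟨T, ⟨?_, ?_, hcont, M + 1, ω, by linarith, fun s => (hTn s).trans ?_⟩, hT, ?_⟩
  · ext x; exact h0 x
  · intro a b; ext x; exact hadd a b x
  · gcongr; linarith
  intro f y hf
  have hT0 : T 0 = ContinuousLinearMap.id 𝕜 E := by ext x; exact h0 x
  refine (hasStrongDerivZero_iff_eventually hT0).2 fun ε hε => ?_
  obtain ⟨C, hC1, hC⟩ := hF.exists_norm_pow_le_of_le 1
  -- Half of `ε` bounds the drift of `y` under the powers, half the first-order defect of `f`. The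
  -- resulting bound `ε * s` is free of `n` and survives the limit.
  obtain ⟨δ, hδ, hy⟩ := hF.exists_forall_norm_pow_sub_le y (half_pos hε)
  have hmem : ∀ᶠ s : ℝ≥0 in 𝓝 0, (s : ℝ) ≤ min δ 1 :=
    (NNReal.continuous_coe.tendsto 0).eventually (Iic_mem_nhds (by simpa using hδ))
  filter_upwards [hmem] with s hs
  have hkh : Tendsto (fun n : ℕ =>
      (((⌊(n : ℝ≥0) * (s / t)⌋₊ : ℝ) * ((t / n : ℝ≥0) : ℝ) : ℝ) : 𝕜) • y) l
      (𝓝 (((s : ℝ) : 𝕜) • y)) := by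
    refine Tendsto.smul_const ?_ y
    have h1 := NNReal.tendsto_coe.2 ((tendsto_natFloor_mul_mul_div t (s / t)).mono_left hl)
    rw [hts] at h1
    have h2 := (RCLike.continuous_ofReal (K := 𝕜)).tendsto (s : ℝ)
    simpa [Function.comp_def] using h2.comp h1
  refine le_of_tendsto (((hT s f).sub_const f).sub hkh).norm ?_
  filter_upwards [hh.eventually hy, hh.eventually
    ((hasStrongDerivZero_iff_eventually hF.map_zero).1 hf (ε / (2 * C)) (by positivity))]
    with n h1 h2
  have hk := hleR s n
  set k := ⌊(n : ℝ≥0) * (s / t)⌋₊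
  set r : ℝ≥0 := t / n
  have hjle : ∀ j < k, (j * r : ℝ) ≤ s := fun j hj => le_trans (by gcongr) hk
  have h3 := norm_pow_sub_sub_smul_le (F r) (C := C) (ε := r * (ε / 2)) (k := k)
    (fun j hj => hC r j ((hjle j hj).trans (hs.trans (min_le_right _ _)))) f (((r : ℝ) : 𝕜) • y)
    (fun j hj => by
      rw [map_smul, ← smul_sub, norm_ofReal_coe_smul]
      gcongr
      exact h1 j ((hjle j hj).trans (hs.trans (min_le_left _ _))))
  rw [smul_smul] at h3
  push_cast at h3 ⊢
  refine h3.trans ?_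
  calc (k : ℝ) * (C * ‖F r f - f - ((r : ℝ) : 𝕜) • y‖ + r * (ε / 2))
      ≤ k * (C * (ε / (2 * C) * r) + r * (ε / 2)) := by gcongr
    _ = ε * (k * r) := by field_simp; ring
    _ ≤ ε * s := by gcongr

end LimitSemigroup

/-! ### Precompact sequences and the main equivalence. -/

theorem isPrecompactSet_range_of_tendsto {E : Type*} [TopologicalSpace E] [T2Space E]
    {u : ℕ → E} {x : E} (hu : Tendsto u atTop (𝓝 x)) : IsPrecompactSet (range u) :=
  hu.isCompact_insert_range.closure_of_subset (subset_insert _ _)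

theorem IsPrecompactSet.exists_tendsto_ultrafilter {E ι : Type*} [TopologicalSpace E] {u : ι → E}
    (hu : IsPrecompactSet (range u)) (l : Ultrafilter ι) : ∃ x, Tendsto u l (𝓝 x) := by
  obtain ⟨x, -, hx⟩ := isCompact_iff_ultrafilter_le_nhds.1 hu (l.map u)
    (le_principal_iff.2 (mem_map.2 (Eventually.of_forall fun n =>
      subset_closure (mem_range_self n))))
  exact ⟨x, hx⟩

theorem mainTheorem5 {𝕜 X : Type*} [RCLike 𝕜] [NormedAddCommGroup X] [NormedSpace 𝕜 X]
    [CompleteSpace X] (Z : X →ₗ.[𝕜] X) (hZ : Dense (Z.domain : Set X))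
    (t : ℝ≥0) (ht : 0 < t) (F : ℝ≥0 → X →L[𝕜] X) (hF : IsChernoffFunction F)
    (hZF : Z.domain ≤ (strongDerivZero F).domain ∧
      ∀ (f : Z.domain) (g : (strongDerivZero F).domain), (f : X) = g →
        strongDerivZero F g = Z f) :
    (Z.IsClosable ∧ IsC0Generator Z.closure) ↔
      ∃ A : Submodule 𝕜 X, A ≤ Z.domain ∧ Dense (A : Set X) ∧
        ∀ f ∈ A, ∀ s : ℝ≥0, ∃ u : ℕ → Z.domain,
          Tendsto (fun n : ℕ => ‖(F (t / n) ^ ⌊(n : ℝ≥0) * s⌋₊) f - (u n : X)‖) atTop (𝓝 0) ∧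
          IsPrecompactSet (range fun n => Z (u n)) ∧
          IsPrecompactSet (range fun n => (u n : X)) := by
  have hZF' : Z ≤ strongDerivZero F := ⟨hZF.1, fun f g hfg => (hZF.2 f g hfg).symm⟩
  constructor
  · rintro ⟨hcl, T, hT, hZT⟩
    refine ⟨Z.domain, le_rfl, hZ, fun f hf s => ?_⟩
    have hgraph : ((strongDerivZero T).graph : Set (X × X)) = closure (Z.graph : Set (X × X)) := by
      rw [← hZT, ← hcl.graph_closure_eq_closure_graph, Submodule.topologicalClosure_coe]
    have hfT : HasStrongDerivZero T f (Z ⟨f, hf⟩) := by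
      refine mem_graph_strongDerivZero.1 ?_
      rw [← SetLike.mem_coe, hgraph]
      exact subset_closure (Z.mem_graph ⟨f, hf⟩)
    have hlim := hF.tendsto_pow_apply hT (hgraph.le.trans
      (closure_mono (LinearPMap.le_graph_of_le hZF'))) hfT ht s
    have hmem : (T (t * s) f, T (t * s) (Z ⟨f, hf⟩)) ∈ closure (Z.graph : Set (X × X)) := by
      rw [← hgraph]
      exact mem_graph_strongDerivZero.2 (hT.hasStrongDerivZero_apply hfT _)
    obtain ⟨v, hv, hvlim⟩ := mem_closure_iff_seq_limit.1 hmem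
    rw [nhds_prod_eq, tendsto_prod_iff'] at hvlim
    choose u hu1 hu2 using fun n => Z.mem_graph_iff.1 (hv n)
    refine ⟨u, ?_, ?_, ?_⟩
    · simpa only [hu1, sub_self, norm_zero] using (hlim.sub hvlim.1).norm
    · simp only [hu2]
      exact isPrecompactSet_range_of_tendsto hvlim.2
    · simp only [hu1]
      exact isPrecompactSet_range_of_tendsto hvlim.1
  · rintro ⟨A, -, hAd, hA⟩
    -- One ultrafilter serves all `f` and all the uncountably many `s` at once, so no diagonal
    -- subsequence is needed.
    have hA' : ∀ f ∈ A, ∀ s : ℝ≥0, ∃ y w, (y, w) ∈ closure (Z.graph : Set (X × X)) ∧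
        Tendsto (fun n : ℕ => (F (t / n) ^ ⌊(n : ℝ≥0) * s⌋₊) f) (hyperfilter ℕ : Filter ℕ)
          (𝓝 y) := by
      intro f hf s
      obtain ⟨u, hu, hZu, hu'⟩ := hA f hf s
      obtain ⟨w, hw⟩ := hZu.exists_tendsto_ultrafilter (hyperfilter ℕ)
      obtain ⟨y, hy⟩ := hu'.exists_tendsto_ultrafilter (hyperfilter ℕ)
      refine ⟨y, w, mem_closure_of_tendsto (hy.prodMk_nhds hw)
        (Eventually.of_forall fun n => Z.mem_graph (u n)), ?_⟩
      have h1 := (tendsto_zero_iff_norm_tendsto_zero.2 hu).mono_left Nat.hyperfilter_le_atTop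
      simpa using h1.add hy
    obtain ⟨T, hT, hlim, hFT⟩ := hF.exists_isC0Semigroup Nat.hyperfilter_le_atTop ht hAd
      fun f hf s => let ⟨y, _, _, h⟩ := hA' f hf s; ⟨y, h⟩
    have hZT : Z ≤ strongDerivZero T := hZF'.trans (LinearPMap.le_of_le_graph fun p hp =>
      mem_graph_strongDerivZero.2 (hFT p.1 p.2 (mem_graph_strongDerivZero.1 hp)))
    have hTc := hT.isClosed_strongDerivZero
    have hcl : Z.IsClosable := hTc.isClosable.leIsClosable hZT
    refine ⟨hcl, T, hT, LinearPMap.eq_of_eq_graph ?_⟩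
    rw [← hcl.graph_closure_eq_closure_graph]
    have hle : Z.graph.topologicalClosure ≤ (strongDerivZero T).graph :=
      Submodule.topologicalClosure_minimal _ (LinearPMap.le_graph_of_le hZT) hTc
    refine le_antisymm hle (hT.graph_strongDerivZero_le
      (Submodule.isClosed_topologicalClosure _) hle hAd fun f hf s => ?_)
    -- `T s` is the limit of the iterates with parameter `s / t`, since `n` steps of length `t / n`
    -- take time `t`. Uniqueness of limits puts `T s f` in the domain of the closure.
    obtain ⟨y, w, hyw, hy⟩ := hA' f hf (s / t)
    rw [tendsto_nhds_unique (hlim s f) hy]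
    exact ⟨w, hyw⟩
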